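/- Let $k$ be a field. A *proalgebraic group* over $k$ is an affine group scheme $G=\operatorname{Spec}(k[G])$ over $k$ (equivalently, $k[G]$ is a commutative Hopf algebra over $k$); it is *algebraic* if it is of finite type over $k$. For a $k$-algebra $R$ (commutative, unital), $G(R)=\operatorname{Hom}_{k\text{-alg}}(k[G],R)$. A morphism $G\to H$ is an *epimorphism* if the dual map $k[H]\to k[G]$ is injective. A *formation* $\mathcal C$ is a class of algebraic groups over $k$, closed under isomorphism, that contains a non-trivial group and is closed under quotients (if $G\to H$ is an epimorphism of algebraic groups and $G\in\mathcal C$, then $H\in\mathcal C$) and under subdirect products (if $G_1,G_2\in\mathcal C$ and $H$ is a closed subgroup of $G_1\times G_2$ such that both projections $H\to G_i$ are epimorphisms, then $H\in\mathcal C$). A *pro-$\mathcal C$-group* is a proalgebraic group that is a projective limit, over a directed partially ordered set, of groups in $\mathcal C$ with epimorphisms as transition maps. Let $G$ be a proalgebraic group, $R$ a $k$-algebra and $X$ a set. A *coalgebraic subgroup* of $G$ is a normal closed subgroup $N$ such that $G/N$ is algebraic. A map $\varphi\colon X\to G(R)$ *converges to $1$* if for every coalgebraic subgroup $N$ of $G$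 the set $\{x\in X:\varphi(x)\notin N(R)\}$ is finite. We write $\langle\varphi(X)\rangle$ for the smallest closed subgroup $H$ of $G$ with $\varphi(X)\subseteq H(R)$. For a morphism $\psi\colon\Gamma\to G$ we denote by $\psi_R\colon\Gamma(R)\to G(R)$ the induced map. **Theorem.** Let $X$ be a set, $\mathcal C$ a formation of algebraic groups over $k$ and $R$ a $k$-algebra. There exist a pro-$\mathcal C$-group $\Gamma=\Gamma^{\mathcal C}_{R/k}(X)$ and a map $\iota\colon X\to\Gamma(R)$ such that 1. $\iota$ converges to $1$ and $\langle\iota(X)\rangle=\Gamma$; 2. for every pro-$\mathcal C$-group $G$ and every map $\varphi\colon X\to G(R)$ that converges to $1$ and satisfies $\langle\varphi(X)\rangle=G$, there exists a unique morphism $\psi\colon\Gamma\to G$ of proalgebraic groups such that $\psi_R\circ\iota=\varphi$. -/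

import Mathlib

open scoped TensorProduct

universe u

noncomputable section

/-- A proalgebraic group over a field `k`, i.e. an affine group scheme over `k`, given by its
coordinate ring `k[G]`, a commutative Hopf algebra over `k` (so that `G = Spec k[G]`). -/
structure ProalgGroup (k : Type u) [Field k] where
  /-- The coordinate ring `k[G]`. -/
  coord : Type u
  [commRing : CommRing coord]
  [hopfAlgebra : HopfAlgebra k coord]

namespace ProalgGroup

attribute [instance] ProalgGroup.commRing ProalgGroup.hopfAlgebra

variable {k : Type u} [Field k]

/-- `G` is an algebraic group: an affine group scheme of finite type over `k`. -/
def IsAlgebraic (G : ProalgGroup k) : Prop :=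
  Algebra.FiniteType k G.coord

/-- `G` is the trivial group scheme: the counit `k[G] → k` is bijective. -/
def IsTrivial (G : ProalgGroup k) : Prop :=
  Function.Bijective (Coalgebra.counit : G.coord →ₗ[k] k)

/-- A morphism `G → H` of proalgebraic groups, given by the dual map `k[H] → k[G]`, a morphism of
Hopf algebras. -/
@[ext]
structure Hom (G H : ProalgGroup k) where
  /-- The dual map `k[H] → k[G]`. -/
  dual : H.coord →ₐc[k] G.coord

/-- The composition `f ∘ g` of `g : G → H` and `f : H → K`. -/
def Hom.comp {G H K : ProalgGroup k} (f : Hom H K) (g : Hom G H) : Hom G K :=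
  ⟨g.dual.comp f.dual⟩

/-- The identity morphism. -/
def Hom.id (G : ProalgGroup k) : Hom G G :=
  ⟨BialgHom.id k G.coord⟩

/-- Epimorphisms: the scheme-theoretic image of `G` is `H`, i.e. the dual map is injective. -/
def Hom.IsEpi {G H : ProalgGroup k} (f : Hom G H) : Prop :=
  Function.Injective f.dual

/-- Isomorphisms: there is an inverse morphism. -/
def Hom.IsIso {G H : ProalgGroup k} (f : Hom G H) : Prop :=
  ∃ g : Hom H G, g.comp f = Hom.id G ∧ f.comp g = Hom.id H

section Points

/-- The set `G(S)` of `S`-points: the `k`-algebra homomorphisms `k[G] → S`, with the convolution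
product (see the group structure below). -/
def Points (G : ProalgGroup k) (S : Type*) [CommRing S] [Algebra k S] : Type _ :=
  WithConv (G.coord →ₐ[k] S)

variable (G : ProalgGroup k) (S : Type*) [CommRing S] [Algebra k S]

/-- The evaluation homomorphism `k[G] → S` of an `S`-point. -/
def Points.eval {G : ProalgGroup k} {S : Type*} [CommRing S] [Algebra k S]
    (g : G.Points S) : G.coord →ₐ[k] S :=
  WithConv.ofConv g

instance : Monoid (G.Points S) :=
  inferInstanceAs (Monoid (WithConv (G.coord →ₐ[k] S)))

instance : Inv (G.Points S) where
  inv g := WithConv.toConv (g.eval.comp (HopfAlgebra.antipodeAlgHom k G.coord))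

/-- The group structure on `G(S)`: the product of `g` and `h` is
`k[G] → k[G] ⊗ k[G] → S` (comultiplication followed by `g ⊗ h`), the unit is given by the counit and
the inverse by the antipode. -/
instance : Group (G.Points S) where
  inv_mul_cancel g := by
    let f : G.coord →ₐ[k] S := g.eval
    have H : (Algebra.TensorProduct.lmul' k).comp (Algebra.TensorProduct.map f f) =
        f.comp (Algebra.TensorProduct.lmul' k) := by ext <;> simp
    change WithConv.toConv ((Algebra.TensorProduct.lmul' k).comp
        ((Algebra.TensorProduct.map (f.comp (HopfAlgebra.antipodeAlgHom k G.coord)) f).comp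
          (Bialgebra.comulAlgHom k G.coord))) =
      (1 : WithConv (G.coord →ₐ[k] S))
    trans WithConv.toConv (((Algebra.TensorProduct.lmul' k).comp
      (Algebra.TensorProduct.map f f)).comp ((Algebra.TensorProduct.map
      (HopfAlgebra.antipodeAlgHom k G.coord) (.id _ _)).comp (Bialgebra.comulAlgHom k G.coord)))
    · rw [AlgHom.comp_assoc, ← AlgHom.comp_assoc (Algebra.TensorProduct.map f f),
        ← Algebra.TensorProduct.map_comp]; rfl
    rw [H, AlgHom.comp_assoc]
    apply WithConv.ofConv_injective
    refine AlgHom.ext fun a => ?_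
    have h := HopfAlgebra.mul_antipode_rTensor_comul_apply (R := k) a
    change f (LinearMap.mul' k G.coord ((HopfAlgebra.antipode k).rTensor G.coord
      (Coalgebra.comul a))) = algebraMap k S (Coalgebra.counit a)
    rw [h, AlgHom.commutes]

/-- The map `f_S : G(S) → H(S)` induced by a morphism `f : G → H`. -/
def Hom.onPoints {G H : ProalgGroup k} (f : Hom G H) {S : Type*} [CommRing S] [Algebra k S]
    (g : G.Points S) : H.Points S :=
  WithConv.toConv (g.eval.comp (f.dual : H.coord →ₐ[k] G.coord))

end Points

/-- A closed subgroup (scheme) of `G`, given by its defining ideal, a Hopf ideal of `k[G]`. -/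
@[ext]
structure ClosedSubgroup (G : ProalgGroup k) where
  /-- The defining ideal in `k[G]`. -/
  ideal : Ideal G.coord
  isHopfIdeal : ideal.IsHopfIdeal k

namespace ClosedSubgroup

variable {G : ProalgGroup k}

/-- The subset `H(S) ⊆ G(S)`: those points `k[G] → S` that vanish on the defining ideal. -/
def points (H : ClosedSubgroup G) (S : Type*) [CommRing S] [Algebra k S] : Set (G.Points S) :=
  {g | ∀ a ∈ H.ideal, g.eval a = 0}

/-- A closed subgroup as a proalgebraic group of its own, with coordinate ring `k[G] / I`. -/
def toProalgGroup (H : ClosedSubgroup G) : ProalgGroup k :=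
  haveI := H.isHopfIdeal
  { coord := G.coord ⧸ H.ideal }

/-- The inclusion of a closed subgroup. -/
def incl (H : ClosedSubgroup G) : Hom H.toProalgGroup G :=
  haveI := H.isHopfIdeal
  ⟨Bialgebra.Quotient.mkBialgHom (R := k) H.ideal⟩

/-- The whole group as a closed subgroup. -/
instance : Top (ClosedSubgroup G) where
  top := ⟨⊥, by
    refine { counit_eq_zero := ?_, map_mkQ_comul_eq_zero := ?_, antipode_mem := ?_ } <;>
    · intro x hx
      have hx : x = 0 := hx
      simp only [hx, map_zero, Ideal.zero_mem]⟩

/-- `N` is a normal closed subgroup: `N(S)` is stable under conjugation by `G(S)` for every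
`k`-algebra `S`. -/
def IsNormal (N : ClosedSubgroup G) : Prop :=
  ∀ (S : Type u) [CommRing S] [Algebra k S] (g n : G.Points S),
    n ∈ N.points S → g * n * g⁻¹ ∈ N.points S

/-- The morphism `π : G → Q` is a quotient of `G` by `N`, i.e. it identifies `Q` with `G / N`:
it is an epimorphism with kernel `N`. -/
def IsQuotient (N : ClosedSubgroup G) {Q : ProalgGroup k} (π : Hom G Q) : Prop :=
  π.IsEpi ∧ ∀ (S : Type u) [CommRing S] [Algebra k S] (g : G.Points S),
    g ∈ N.points S ↔ π.onPoints g = 1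

/-- `N` is a coalgebraic subgroup of `G`: a normal closed subgroup such that the quotient `G / N`
is algebraic. -/
def IsCoalgebraic (N : ClosedSubgroup G) : Prop :=
  N.IsNormal ∧ ∃ (Q : ProalgGroup k) (π : Hom G Q), N.IsQuotient π ∧ Q.IsAlgebraic

variable {R : Type*} [CommRing R] [Algebra k R]

/-- The closed subgroup `⟨X⟩` of `G` generated by a set `X ⊆ G(R)` of `R`-points: the intersection
of all closed subgroups `H` of `G` with `X ⊆ H(R)`. (The defining ideal of an intersection is the
sum of the defining ideals.) -/
def generatedBy (X : Set (G.Points R)) : ClosedSubgroup G where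
  ideal := ⨆ H ∈ {H : ClosedSubgroup G | X ⊆ H.points R}, H.ideal
  isHopfIdeal := by
    set J : Ideal G.coord := ⨆ H ∈ {H : ClosedSubgroup G | X ⊆ H.points R}, H.ideal with hJ
    have hle : ∀ H : ClosedSubgroup G, X ⊆ H.points R → H.ideal ≤ J := fun H hH =>
      le_iSup₂_of_le (f := fun (H : ClosedSubgroup G)
        (_ : H ∈ {H : ClosedSubgroup G | X ⊆ H.points R}) => H.ideal) H hH le_rfl
    have h1 : J ≤ RingHom.ker (Bialgebra.counitAlgHom k G.coord) :=
      iSup₂_le fun H _ x hx => H.isHopfIdeal.counit_eq_zero hx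
    have h2 : J ≤ RingHom.ker ((Algebra.TensorProduct.map (Ideal.Quotient.mkₐ k J)
        (Ideal.Quotient.mkₐ k J)).comp (Bialgebra.comulAlgHom k G.coord)) := by
      refine iSup₂_le fun H hH x hx => ?_
      have h := H.isHopfIdeal.map_mkQ_comul_eq_zero hx
      let q : (G.coord ⧸ H.ideal) →ₐ[k] (G.coord ⧸ J) := Ideal.Quotient.factorₐ k (hle H hH)
      have hq : Algebra.TensorProduct.map (Ideal.Quotient.mkₐ k J) (Ideal.Quotient.mkₐ k J) =
          (Algebra.TensorProduct.map q q).comp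
            (Algebra.TensorProduct.map (Ideal.Quotient.mkₐ k H.ideal)
              (Ideal.Quotient.mkₐ k H.ideal)) := by
        rw [← Algebra.TensorProduct.map_comp]
        rfl
      have h' : Algebra.TensorProduct.map (Ideal.Quotient.mkₐ k H.ideal)
          (Ideal.Quotient.mkₐ k H.ideal) (Coalgebra.comul (R := k) x) = 0 := h
      change Algebra.TensorProduct.map (Ideal.Quotient.mkₐ k J) (Ideal.Quotient.mkₐ k J)
        (Coalgebra.comul (R := k) x) = 0
      rw [hq, AlgHom.comp_apply, h', map_zero]
    have h3 : J ≤ J.comap (HopfAlgebra.antipodeAlgHom k G.coord) :=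
      iSup₂_le fun H hH x hx => hle H hH (H.isHopfIdeal.antipode_mem hx)
    exact { counit_eq_zero := fun x hx => h1 hx
            map_mkQ_comul_eq_zero := fun x hx => h2 hx
            antipode_mem := fun x hx => h3 hx }

end ClosedSubgroup

/-- The product `G₁ × G₂`, with coordinate ring `k[G₁] ⊗ k[G₂]`. -/
def prod (G₁ G₂ : ProalgGroup k) : ProalgGroup k where
  coord := G₁.coord ⊗[k] G₂.coord

/-- The first projection `G₁ × G₂ → G₁`, dual to `a ↦ a ⊗ 1`. -/
def fst (G₁ G₂ : ProalgGroup k) : Hom (G₁.prod G₂) G₁ :=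
  ⟨(Bialgebra.TensorProduct.map (BialgHom.id k G₁.coord) (Bialgebra.unitBialgHom k G₂.coord)).comp
    ((Bialgebra.TensorProduct.rid k k G₁.coord).symm : G₁.coord →ₐc[k] G₁.coord ⊗[k] k)⟩

/-- The second projection `G₁ × G₂ → G₂`, dual to `b ↦ 1 ⊗ b`. -/
def snd (G₁ G₂ : ProalgGroup k) : Hom (G₁.prod G₂) G₂ :=
  ⟨(Bialgebra.TensorProduct.map (Bialgebra.unitBialgHom k G₁.coord) (BialgHom.id k G₂.coord)).comp
    ((Bialgebra.TensorProduct.lid k G₂.coord).symm : G₂.coord →ₐc[k] k ⊗[k] G₂.coord)⟩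

/-- A class `C` of algebraic groups, closed under isomorphism, is a formation if it is closed under
quotients and under subdirect products and contains a non-trivial group. -/
structure IsFormation (C : ProalgGroup k → Prop) : Prop where
  isAlgebraic : ∀ G, C G → G.IsAlgebraic
  of_iso : ∀ (G H : ProalgGroup k) (f : Hom G H), f.IsIso → C G → C H
  quotient : ∀ (G H : ProalgGroup k) (f : Hom G H), H.IsAlgebraic → f.IsEpi → C G → C H
  subdirect : ∀ (G₁ G₂ : ProalgGroup k) (H : ClosedSubgroup (G₁.prod G₂)), C G₁ → C G₂ →
    ((fst G₁ G₂).comp H.incl).IsEpi → ((snd G₁ G₂).comp H.incl).IsEpi → C H.toProalgGroup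
  nontrivial : ∃ G, C G ∧ ¬ G.IsTrivial

/-- `G`, with the morphisms `p i : G → F i`, is the projective limit of the groups `F i` with
transition maps `t h : F j → F i` (`i ≤ j`). Projective limits of group schemes are pointwise:
`G(S)` is the set of compatible families in the `(F i)(S)`, for every `k`-algebra `S`. -/
def IsProjLimit {I : Type u} [Preorder I] (F : I → ProalgGroup k)
    (t : ∀ {i j : I}, i ≤ j → Hom (F j) (F i)) (G : ProalgGroup k) (p : ∀ i, Hom G (F i)) : Prop :=
  (∀ (i j : I) (h : i ≤ j), (t h).comp (p j) = p i) ∧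
  ∀ (S : Type u) [CommRing S] [Algebra k S] (g : ∀ i, (F i).Points S),
    (∀ (i j : I) (h : i ≤ j), (t h).onPoints (g j) = g i) →
      ∃! x : G.Points S, ∀ i, (p i).onPoints x = g i

/-- `G` is a pro-`C`-group: the projective limit of a projective system, over a (non-empty) directed
partially ordered set, of groups in `C` with epimorphisms as transition maps. -/
def IsPro (C : ProalgGroup k → Prop) (G : ProalgGroup k) : Prop :=
  ∃ (I : Type u) (_ : PartialOrder I) (_ : Nonempty I) (_ : IsDirectedOrder I)
    (F : I → ProalgGroup k) (t : ∀ {i j : I}, i ≤ j → Hom (F j) (F i)) (p : ∀ i, Hom G (F i)),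
    (∀ i, C (F i)) ∧
    (∀ i, t (le_refl i) = Hom.id (F i)) ∧
    (∀ (i j l : I) (hij : i ≤ j) (hjl : j ≤ l), (t hij).comp (t hjl) = t (hij.trans hjl)) ∧
    (∀ (i j : I) (h : i ≤ j), (t h).IsEpi) ∧
    IsProjLimit F t G p

variable {G : ProalgGroup k} {R : Type*} [CommRing R] [Algebra k R] {X : Type*}

/-- `φ : X → G(R)` converges to `1`: for every coalgebraic subgroup `N` of `G`, all but finitely many
elements of `X` are mapped into `N(R)`. -/
def ConvergesToOne (φ : X → G.Points R) : Prop :=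
  ∀ N : ClosedSubgroup G, N.IsCoalgebraic → {x | φ x ∉ N.points R}.Finite

/-- `φ(X)` generates `G`: `⟨φ(X)⟩ = G`. -/
def Generates (φ : X → G.Points R) : Prop :=
  ClosedSubgroup.generatedBy (Set.range φ) = ⊤

end ProalgGroup

end

noncomputable section

/-! ### Hopf algebras, Hopf ideals and homomorphisms -/

section Hopf

open HopfAlgebra Coalgebra Bialgebra WithConv

/-! `Γ` is built like a free profinite group. Up to isomorphism the algebraic groups form a set, so
there is a set `J` of pairs consisting of a representative `F j` in `C` and a map `X → F j (R)` that
is almost everywhere `1` and generates `F j`. These maps combine to a map from `X` to the `R`-points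
of the product of all `F j`; `Γ` is the closed subgroup generated by its image.

Everything rests on three consequences of generation: a morphism whose image contains generating
points is an epimorphism (`Generates.isEpi`), morphisms agreeing on generating points are equal
(`Generates.hom_ext`), and epimorphisms preserve generation (`Generates.map`). By the first, every
projection `Γ → F j` is an epimorphism. Since the subalgebras `k[F j]` generate `k[Γ]`, closure of
`C` under subdirect products makes `Γ` pro-`C` (`IsFormation.isPro`), and convergence needs checking
only in the `F j` (`convergesToOne_of_iSup`).

For the universal property write `G` as the limit of groups `E i` in `C`. The limit projections are
epimorphisms (`IsProjLimit.isEpi`), so the induced map `X → E i (R)` is, up to isomorphism, a member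
of `J`, and a projection of `Γ` yields `Γ → E i`. These morphisms are compatible because `ι(X)`
generates `Γ`, so they glue to `Γ → G` (`IsProjLimit.exists_lift`); uniqueness is
`Generates.hom_ext` again. -/

/-- Both sides are convolution inverses of `f` among the linear maps `A → B`, and such an inverse is
unique. -/
theorem BialgHom.map_antipode {k A B : Type*} [CommRing k] [CommRing A] [CommRing B]
    [HopfAlgebra k A] [HopfAlgebra k B] (f : A →ₐc[k] B) (a : A) :
    f (antipode k a) = antipode k (f a) := by
  have h : toConv (f.toLinearMap ∘ₗ antipode k) = toConv (antipode k ∘ₗ f.toLinearMap) := by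
    apply left_inv_eq_right_inv (a := toConv f.toLinearMap)
    · apply ofConv_injective
      calc (toConv (f.toLinearMap ∘ₗ antipode k) * toConv f.toLinearMap).ofConv
        _ = (AlgHomClass.toAlgHom f).toLinearMap ∘ₗ
            (toConv (antipode k) * toConv .id : WithConv (A →ₗ[k] A)).ofConv := by
          rw [LinearMap.algHom_comp_convMul_distrib]; rfl
        _ = _ := by rw [LinearMap.antipode_mul_id, LinearMap.algHom_comp_convOne]
    · apply ofConv_injective
      calc (toConv f.toLinearMap * toConv (antipode k ∘ₗ f.toLinearMap)).ofConv
        _ = (toConv .id * toConv (antipode k) : WithConv (B →ₗ[k] B)).ofConv ∘ₗ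
          f.toCoalgHom.toLinearMap := by
          rw [LinearMap.convMul_comp_coalgHom_distrib]; rfl
        _ = _ := by rw [LinearMap.id_mul_antipode, LinearMap.convOne_comp_coalgHom]
  exact congr($(toConv_injective h) a)

/-- Homomorphisms from an algebra generated by the ranges of a family agree if they agree on the
family. -/
theorem AlgHom.ext_of_iSup_range {k J H S : Type*} {A : J → Type*} [CommRing k]
    [∀ j, CommRing (A j)] [∀ j, Algebra k (A j)] [CommRing H] [Algebra k H] [Semiring S]
    [Algebra k S] {i : ∀ j, A j →ₐ[k] H} (hi : ⨆ j, (i j).range = ⊤) {f g : H →ₐ[k] S}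
    (h : ∀ j, f.comp (i j) = g.comp (i j)) : f = g := by
  rw [← AlgHom.equalizer_eq_top, eq_top_iff, ← hi]
  refine iSup_le fun j => ?_
  rintro _ ⟨a, rfl⟩
  exact congr($(h j) a)

/-- An algebra generated by the images of Hopf algebras is a Hopf algebra, as soon as it has
structure maps that are compatible with theirs. -/
abbrev HopfAlgebra.ofFamily {k J H : Type*} {A : J → Type*} [CommRing k]
    [∀ j, CommRing (A j)] [∀ j, HopfAlgebra k (A j)] [CommRing H] [Algebra k H]
    (i : ∀ j, A j →ₐ[k] H) (hi : ⨆ j, (i j).range = ⊤)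
    (Δ : H →ₐ[k] H ⊗[k] H) (ε : H →ₐ[k] k) (S : H →ₐ[k] H)
    (hΔ : ∀ j, Δ.comp (i j) =
      (Algebra.TensorProduct.map (i j) (i j)).comp (comulAlgHom k (A j)))
    (hε : ∀ j, ε.comp (i j) = counitAlgHom k (A j))
    (hS : ∀ j, S.comp (i j) = (i j).comp (antipodeAlgHom k (A j))) : HopfAlgebra k H :=
  have hΔ' : ∀ j a, Δ (i j a) = Algebra.TensorProduct.map (i j) (i j) (comul (R := k) a) :=
    fun j a => congr($(hΔ j) a)
  have hε' : ∀ j a, ε (i j a) = counit (R := k) a := fun j a => congr($(hε j) a)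
  have hS' : ∀ j a, S (i j a) = i j (antipode k a) := fun j a => congr($(hS j) a)
  -- Each axiom is an equality of algebra homomorphisms out of `H`, so it suffices to check it on
  -- the images of the `A j`, where it is the image of the same axiom for `A j`.
  letI : Bialgebra k H := Bialgebra.ofAlgHom Δ ε
    (by
      refine AlgHom.ext_of_iSup_range hi fun j => AlgHom.ext fun a => ?_
      have h1 : ∀ z : A j ⊗[k] A j, Algebra.TensorProduct.assoc k k k H H H
          (Algebra.TensorProduct.map Δ (.id k H) (Algebra.TensorProduct.map (i j) (i j) z)) =
          Algebra.TensorProduct.map (i j) (Algebra.TensorProduct.map (i j) (i j))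
            (TensorProduct.assoc k _ _ _ ((comul (R := k)).rTensor _ z)) := by
        intro z
        induction z with
        | zero => simp
        | add x y hx hy => simp only [map_add, hx, hy]
        | tmul x y =>
          simp only [Algebra.TensorProduct.map_tmul, hΔ', AlgHom.id_apply, LinearMap.rTensor_tmul]
          induction comul (R := k) x with
          | zero => simp
          | add x y hx hy => simp only [map_add, TensorProduct.add_tmul, hx, hy]
          | tmul x y => simp
      have h2 : ∀ z : A j ⊗[k] A j,
          Algebra.TensorProduct.map (.id k H) Δ (Algebra.TensorProduct.map (i j) (i j) z) =
          Algebra.TensorProduct.map (i j) (Algebra.TensorProduct.map (i j) (i j))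
            ((comul (R := k)).lTensor _ z) := by
        intro z
        induction z with
        | zero => simp
        | add x y hx hy => simp only [map_add, hx, hy]
        | tmul x y => simp [hΔ']
      have h3 := h1 (comul a)
      have h4 := h2 (comul a)
      rw [Coalgebra.coassoc_apply, ← h4] at h3
      simpa [hΔ'] using h3)
    (by
      refine AlgHom.ext_of_iSup_range hi fun j => AlgHom.ext fun a => ?_
      have h1 : ∀ z : A j ⊗[k] A j,
          Algebra.TensorProduct.map ε (.id k H) (Algebra.TensorProduct.map (i j) (i j) z) =
          Algebra.TensorProduct.map (.id k k) (i j) ((counit (R := k)).rTensor _ z) := by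
        intro z
        induction z with
        | zero => simp
        | add x y hx hy => simp only [map_add, hx, hy]
        | tmul x y => simp [hε']
      have h3 := h1 (comul a)
      rw [Coalgebra.rTensor_counit_comul] at h3
      simpa [hΔ'] using h3)
    (by
      refine AlgHom.ext_of_iSup_range hi fun j => AlgHom.ext fun a => ?_
      have h1 : ∀ z : A j ⊗[k] A j,
          Algebra.TensorProduct.map (.id k H) ε (Algebra.TensorProduct.map (i j) (i j) z) =
          Algebra.TensorProduct.map (i j) (.id k k) ((counit (R := k)).lTensor _ z) := by
        intro z
        induction z with
        | zero => simp
        | add x y hx hy => simp only [map_add, hx, hy]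
        | tmul x y => simp [hε']
      have h3 := h1 (comul a)
      rw [Coalgebra.lTensor_counit_comul] at h3
      simpa [hΔ'] using h3)
  HopfAlgebra.ofAlgHom S
    (by
      refine AlgHom.ext_of_iSup_range hi fun j => AlgHom.ext fun a => ?_
      have h1 : ∀ z : A j ⊗[k] A j,
          Algebra.TensorProduct.lift S (.id k H) (fun _ => Commute.all _)
            (Algebra.TensorProduct.map (i j) (i j) z) =
          i j (LinearMap.mul' k (A j) ((antipode k).rTensor _ z)) := by
        intro z
        induction z with
        | zero => simp
        | add x y hx hy => simp only [map_add, hx, hy]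
        | tmul x y =>
          simp only [Algebra.TensorProduct.map_tmul, LinearMap.rTensor_tmul, LinearMap.mul'_apply,
            map_mul]
          exact (Algebra.TensorProduct.lift_tmul ..).trans (congrArg (· * i j y) (hS' j x))
      have h3 := h1 (comul a)
      rw [HopfAlgebra.mul_antipode_rTensor_comul_apply, AlgHom.commutes, ← hε', ← hΔ'] at h3
      exact h3)
    (by
      refine AlgHom.ext_of_iSup_range hi fun j => AlgHom.ext fun a => ?_
      have h1 : ∀ z : A j ⊗[k] A j,
          Algebra.TensorProduct.lift (.id k H) S (fun _ _ => Commute.all _ _)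
            (Algebra.TensorProduct.map (i j) (i j) z) =
          i j (LinearMap.mul' k (A j) ((antipode k).lTensor _ z)) := by
        intro z
        induction z with
        | zero => simp
        | add x y hx hy => simp only [map_add, hx, hy]
        | tmul x y => simp [hS']
      have h3 := h1 (comul a)
      rw [HopfAlgebra.mul_antipode_lTensor_comul_apply, AlgHom.commutes, ← hε', ← hΔ'] at h3
      exact h3)

theorem Algebra.TensorProduct.map_injective_of_field {k A B A' B' : Type*} [Field k] [CommRing A]
    [CommRing B] [CommRing A'] [CommRing B'] [Algebra k A] [Algebra k B] [Algebra k A']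
    [Algebra k B'] {f : A →ₐ[k] A'} {g : B →ₐ[k] B'}
    (hf : Function.Injective f) (hg : Function.Injective g) :
    Function.Injective (Algebra.TensorProduct.map f g) :=
  TensorProduct.map_injective_of_flat_flat f.toLinearMap g.toLinearMap hf hg

section Field

variable {k A B D : Type*} [Field k] [CommRing A] [CommRing B] [CommRing D]
  [HopfAlgebra k A] [HopfAlgebra k B] [HopfAlgebra k D]

/-- A homomorphism whose image lies in the image of an injective one factors through it. -/
theorem BialgHom.exists_comp_eq_of_range_le (f : A →ₐc[k] D) (g : B →ₐc[k] D)
    (hg : Function.Injective g) (h : (f : A →ₐ[k] D).range ≤ (g : B →ₐ[k] D).range) :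
    ∃ e : A →ₐc[k] B, g.comp e = f := by
  let e' := AlgEquiv.ofInjective (g : B →ₐ[k] D) hg
  let e : A →ₐ[k] B := (e'.symm : _ →ₐ[k] B).comp
    ((Subalgebra.inclusion h).comp (f : A →ₐ[k] D).rangeRestrict)
  have he : ∀ a, g (e a) = f a := fun a => congrArg Subtype.val (e'.apply_symm_apply _)
  have he' : (g : B →ₐ[k] D).comp e = f := AlgHom.ext he
  refine ⟨.ofAlgHom e ?_ ?_, BialgHom.ext he⟩
  · ext a
    have h1 : counit (R := k) (g (e a)) = counit (R := k) (e a) := CoalgHomClass.counit_comp_apply g _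
    have h2 : counit (R := k) (f a) = counit (R := k) a := CoalgHomClass.counit_comp_apply f _
    change counit (R := k) (e a) = counit (R := k) a
    rw [← h1, he, h2]
  · apply AlgHom.ext fun a => ?_
    -- Over a field `g ⊗ g` is again injective, so compatibility with comultiplication can be tested
    -- in `D ⊗ D`, where it is that of `f`.
    apply Algebra.TensorProduct.map_injective_of_field (f := (g : B →ₐ[k] D))
      (g := (g : B →ₐ[k] D)) hg hg
    have h1 := congr($(BialgHom.map_comp_comulAlgHom g) (e a))
    have h2 := congr($(BialgHom.map_comp_comulAlgHom f) a)
    simp only [AlgHom.comp_apply] at h1 h2 ⊢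
    rw [h1, ← AlgHom.comp_apply (Algebra.TensorProduct.map _ _), ← Algebra.TensorProduct.map_comp,
      he', h2]
    exact congrArg _ (he a).symm

theorem Ideal.isHopfIdeal_span {s : Set A} (hε : ∀ a ∈ s, counit (R := k) a = 0)
    (hΔ : ∀ a ∈ s, Algebra.TensorProduct.map (Ideal.Quotient.mkₐ k (Ideal.span s))
      (Ideal.Quotient.mkₐ k (Ideal.span s)) (comul (R := k) a) = 0)
    (hS : ∀ a ∈ s, antipode k a ∈ Ideal.span s) : (Ideal.span s).IsHopfIdeal k := by
  have h1 : Ideal.span s ≤ RingHom.ker (counitAlgHom k A) := Ideal.span_le.2 hε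
  have h2 : Ideal.span s ≤ RingHom.ker ((Algebra.TensorProduct.map
      (Ideal.Quotient.mkₐ k (Ideal.span s)) (Ideal.Quotient.mkₐ k (Ideal.span s))).comp
        (comulAlgHom k A)) := Ideal.span_le.2 hΔ
  have h3 : Ideal.span s ≤ (Ideal.span s).comap (antipodeAlgHom k A) := Ideal.span_le.2 hS
  exact { counit_eq_zero := fun x hx => h1 hx
          map_mkQ_comul_eq_zero := fun x hx => h2 hx
          antipode_mem := fun x hx => h3 hx }

theorem Ideal.IsHopfIdeal.map {I : Ideal A} (hI : I.IsHopfIdeal k) (f : A →ₐc[k] B) :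
    (I.map f).IsHopfIdeal k := by
  refine Ideal.isHopfIdeal_span ?_ ?_ ?_
  · rintro _ ⟨a, ha, rfl⟩
    exact (CoalgHomClass.counit_comp_apply f a).trans (hI.counit_eq_zero ha)
  · rintro _ ⟨a, ha, rfl⟩
    set J := Ideal.span (f '' (I : Set A))
    have hIJ : ∀ a ∈ I, (Ideal.Quotient.mkₐ k J).comp (f : A →ₐ[k] B) a = 0 := fun a ha =>
      Ideal.Quotient.eq_zero_iff_mem.2 (Ideal.subset_span ⟨a, ha, rfl⟩)
    -- As `A → B ⧸ J` kills `I`, it factors through `A ⧸ I`, where the comultiplication of `a`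
    -- already vanishes.
    let q : (A ⧸ I) →ₐ[k] (B ⧸ J) := Ideal.Quotient.liftₐ I _ hIJ
    have h1 : Algebra.TensorProduct.map (Ideal.Quotient.mkₐ k I) (Ideal.Quotient.mkₐ k I)
        (comul (R := k) a) = 0 := hI.map_mkQ_comul_eq_zero ha
    have h2 := congr($(BialgHom.map_comp_comulAlgHom f) a)
    simp only [AlgHom.comp_apply] at h2
    change Algebra.TensorProduct.map _ _ (comulAlgHom k B (f a)) = 0
    erw [← h2]
    rw [← AlgHom.comp_apply, ← Algebra.TensorProduct.map_comp,
      show (Ideal.Quotient.mkₐ k J).comp (f : A →ₐ[k] B) = q.comp (Ideal.Quotient.mkₐ k I) from rfl,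
      Algebra.TensorProduct.map_comp, AlgHom.comp_apply]
    erw [h1]
    exact map_zero _
  · rintro _ ⟨a, ha, rfl⟩
    change antipode k (f a) ∈ _
    rw [← f.map_antipode]
    exact Ideal.subset_span ⟨_, hI.antipode_mem ha, rfl⟩

/-- The quotient by the kernel embeds in `B`; over a field so does its tensor square in `B ⊗ B`,
where the coideal condition becomes the compatibility of `f` with comultiplication. -/
theorem BialgHom.isHopfIdeal_ker (f : A →ₐc[k] B) : (RingHom.ker f).IsHopfIdeal k := by
  refine { counit_eq_zero := ?_, map_mkQ_comul_eq_zero := ?_, antipode_mem := ?_ }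
  · intro a ha
    rw [← CoalgHomClass.counit_comp_apply f a]
    exact (congrArg _ ha).trans (map_zero _)
  · intro a ha
    let q : (A ⧸ RingHom.ker f) →ₐ[k] B := Ideal.Quotient.liftₐ _ (f : A →ₐ[k] B) (fun _ h => h)
    have hq : Function.Injective q :=
      (injective_iff_map_eq_zero q).2 fun x => by
        obtain ⟨x, rfl⟩ := Ideal.Quotient.mk_surjective x
        exact fun h => Ideal.Quotient.eq_zero_iff_mem.2 h
    refine Algebra.TensorProduct.map_injective_of_field hq hq (Eq.trans ?_ (map_zero _).symm)
    change Algebra.TensorProduct.map q q (Algebra.TensorProduct.map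
      (Ideal.Quotient.mkₐ k (RingHom.ker f)) (Ideal.Quotient.mkₐ k (RingHom.ker f))
        (comul (R := k) a)) = 0
    rw [← AlgHom.comp_apply, ← Algebra.TensorProduct.map_comp]
    have h2 := congr($(BialgHom.map_comp_comulAlgHom f) a)
    refine Eq.trans h2 ?_
    have ha : f a = 0 := ha
    change comulAlgHom k B (f a) = 0
    rw [ha, map_zero]
  · intro a ha
    have ha : f a = 0 := ha
    change f (antipode k a) = 0
    rw [f.map_antipode, ha, map_zero]

/-- The ideal generated by the differences of the values of two homomorphisms. -/
theorem BialgHom.isHopfIdeal_span_sub (f g : A →ₐc[k] B) :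
    (Ideal.span (Set.range fun a => f a - g a)).IsHopfIdeal k := by
  refine Ideal.isHopfIdeal_span ?_ ?_ ?_
  · rintro _ ⟨a, rfl⟩
    rw [map_sub, CoalgHomClass.counit_comp_apply, CoalgHomClass.counit_comp_apply, sub_self]
  · rintro _ ⟨a, rfl⟩
    set J := Ideal.span (Set.range fun a => f a - g a)
    have h : (Ideal.Quotient.mkₐ k J).comp (f : A →ₐ[k] B) =
        (Ideal.Quotient.mkₐ k J).comp (g : A →ₐ[k] B) :=
      AlgHom.ext fun a => Ideal.Quotient.eq.2 (Ideal.subset_span ⟨a, rfl⟩)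
    have h1 := congrArg (Algebra.TensorProduct.map (Ideal.Quotient.mkₐ k J)
      (Ideal.Quotient.mkₐ k J)) congr($(BialgHom.map_comp_comulAlgHom f) a)
    have h2 := congrArg (Algebra.TensorProduct.map (Ideal.Quotient.mkₐ k J)
      (Ideal.Quotient.mkₐ k J)) congr($(BialgHom.map_comp_comulAlgHom g) a)
    rw [← AlgHom.comp_apply, ← AlgHom.comp_assoc, ← Algebra.TensorProduct.map_comp] at h1 h2
    rw [h] at h1
    change Algebra.TensorProduct.map _ _ (comulAlgHom k B (f a - g a)) = 0
    rw [map_sub, map_sub, sub_eq_zero]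
    exact h1.symm.trans h2
  · rintro _ ⟨a, rfl⟩
    change antipode k (f a - g a) ∈ _
    rw [map_sub, ← f.map_antipode, ← g.map_antipode]
    exact Ideal.subset_span ⟨_, rfl⟩

end Field

end Hopf
end

noncomputable section

/-! ### Coproducts of commutative Hopf algebras -/

section Coproduct

variable {k J : Type u} [Field k] (A : J → Type u) [∀ j, CommRing (A j)] [∀ j, Algebra k (A j)]

/-- The relations between the generators of the coproduct of a family of commutative algebras. -/
def AlgCoproduct.relations (k : Type u) [Field k] [∀ j, Algebra k (A j)] :
    Ideal (MvPolynomial (Σ j, A j) k) :=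
  Ideal.span {p | ∃ (j : J) (q : MvPolynomial (A j) k), MvPolynomial.aeval id q = 0 ∧
    p = MvPolynomial.rename (Sigma.mk j) q}

/-- The coproduct of a family of commutative algebras. -/
abbrev AlgCoproduct (k : Type u) [Field k] [∀ j, Algebra k (A j)] : Type u :=
  MvPolynomial (Σ j, A j) k ⧸ AlgCoproduct.relations A k

namespace AlgCoproduct

variable {A}

theorem mk_rename_eq_zero {j : J} (q : MvPolynomial (A j) k) (hq : MvPolynomial.aeval id q = 0) :
    Ideal.Quotient.mkₐ k (relations A k) (MvPolynomial.rename (Sigma.mk j) q) = 0 :=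
  Ideal.Quotient.eq_zero_iff_mem.2 (Ideal.subset_span ⟨j, q, hq, rfl⟩)

/-- The relations contain every polynomial identity valid in `A j`, so each homomorphism axiom for
`incl` is an instance of this lemma. -/
theorem mk_rename_congr {j : J} {p q : MvPolynomial (A j) k}
    (h : MvPolynomial.aeval (R := k) id p = MvPolynomial.aeval id q) :
    Ideal.Quotient.mkₐ k (relations A k) (MvPolynomial.rename (Sigma.mk j) p) =
      Ideal.Quotient.mkₐ k (relations A k) (MvPolynomial.rename (Sigma.mk j) q) := by
  rw [← sub_eq_zero, ← map_sub, ← map_sub]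
  exact mk_rename_eq_zero _ (by rw [map_sub, h, sub_self])

/-- The inclusion of a factor. -/
def incl (j : J) : A j →ₐ[k] AlgCoproduct A k where
  toFun a := Ideal.Quotient.mkₐ k (relations A k)
    (MvPolynomial.rename (Sigma.mk j) (MvPolynomial.X a))
  map_one' := (mk_rename_congr (q := 1) (by simp)).trans (by simp)
  map_mul' a b := (mk_rename_congr (q := .X a * .X b) (by simp)).trans (by simp)
  map_zero' := (mk_rename_congr (q := 0) (by simp)).trans (by simp)
  map_add' a b := (mk_rename_congr (q := .X a + .X b) (by simp)).trans (by simp)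
  commutes' c := (mk_rename_congr (q := algebraMap _ _ c) (by simp)).trans (by simp)

theorem iSup_range_incl : ⨆ j, (incl (k := k) (A := A) j).range = ⊤ := by
  refine eq_top_iff.2 fun x _ => ?_
  obtain ⟨p, rfl⟩ := Ideal.Quotient.mk_surjective x
  induction p using MvPolynomial.induction_on with
  | C c => exact Subalgebra.algebraMap_mem _ c
  | add p q hp hq => 
    rw [map_add]
    exact add_mem (hp trivial) (hq trivial)
  | mul_X p a hp =>
    rw [map_mul]
    refine mul_mem (hp trivial) (le_iSup (fun j => (incl (k := k) (A := A) j).range) a.1 ⟨a.2, ?_⟩)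
    change Ideal.Quotient.mk _ _ = _
    rw [MvPolynomial.rename_X]

/-- The universal property of the coproduct. -/
def lift {S : Type*} [CommRing S] [Algebra k S] (f : ∀ j, A j →ₐ[k] S) : AlgCoproduct A k →ₐ[k] S :=
  Ideal.Quotient.liftₐ _ (MvPolynomial.aeval fun a => f a.1 a.2) fun a ha => by
    have h : relations A k ≤ RingHom.ker (MvPolynomial.aeval (R := k)
        fun a : Σ j, A j => f a.1 a.2) := by
      refine Ideal.span_le.2 ?_
      rintro _ ⟨j, q, hq, rfl⟩
      change MvPolynomial.aeval _ _ = 0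
      rw [MvPolynomial.aeval_rename]
      have : MvPolynomial.aeval ((fun a : Σ j, A j => f a.1 a.2) ∘ Sigma.mk j) q =
          f j (MvPolynomial.aeval id q) := by
        rw [← AlgHom.comp_apply]
        congr 1
        ext
        simp
      rw [this, hq, map_zero]
    exact h ha

theorem lift_comp_incl {S : Type*} [CommRing S] [Algebra k S] (f : ∀ j, A j →ₐ[k] S) (j : J) :
    (lift f).comp (incl j) = f j := by
  ext a
  change MvPolynomial.aeval _ (MvPolynomial.rename (Sigma.mk j) (MvPolynomial.X a)) = _
  simp

end AlgCoproduct

namespace AlgCoproduct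

variable (A : J → Type u) [∀ j, CommRing (A j)] [∀ j, HopfAlgebra k (A j)]

instance : HopfAlgebra k (AlgCoproduct A k) :=
  HopfAlgebra.ofFamily (A := A) incl iSup_range_incl
    (lift fun j => (Algebra.TensorProduct.map (incl j) (incl j)).comp
      (Bialgebra.comulAlgHom k (A j)))
    (lift fun j => Bialgebra.counitAlgHom k (A j))
    (lift fun j => (incl j).comp (HopfAlgebra.antipodeAlgHom k (A j)))
    (lift_comp_incl _) (lift_comp_incl _) (lift_comp_incl _)

/-- The inclusion of a factor into the coproduct of commutative Hopf algebras. -/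
def inclBialgHom (j : J) : A j →ₐc[k] AlgCoproduct A k :=
  .ofAlgHom (incl j) (lift_comp_incl (fun j => Bialgebra.counitAlgHom k (A j)) j)
    (by exact (lift_comp_incl (S := AlgCoproduct A k ⊗[k] AlgCoproduct A k)
      (fun j => (Algebra.TensorProduct.map (incl j) (incl j)).comp
      (Bialgebra.comulAlgHom k (A j))) j).symm)

end AlgCoproduct

end Coproduct

/-! ### Transport of structure and smallness of the class of algebraic groups -/

section Transport

variable {k A B : Type*} [Field k] [CommRing A] [HopfAlgebra k A] [CommRing B] [Algebra k B]

theorem AlgEquiv.iSup_range_eq_top (e : A ≃ₐ[k] B) :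
    ⨆ _ : Unit, (e : A →ₐ[k] B).range = ⊤ := by
  rw [iSup_const, AlgHom.range_eq_top]
  exact e.surjective

/-- Transfer of a Hopf algebra structure along an algebra isomorphism. -/
abbrev AlgEquiv.hopfAlgebra (e : A ≃ₐ[k] B) : HopfAlgebra k B :=
  HopfAlgebra.ofFamily (J := Unit) (A := fun _ => A) (fun _ => (e : A →ₐ[k] B)) e.iSup_range_eq_top
    (((Algebra.TensorProduct.map (e : A →ₐ[k] B) (e : A →ₐ[k] B)).comp
      (Bialgebra.comulAlgHom k A)).comp e.symm)
    ((Bialgebra.counitAlgHom k A).comp e.symm)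
    (((e : A →ₐ[k] B).comp (HopfAlgebra.antipodeAlgHom k A)).comp e.symm)
    (fun _ => by ext; simp) (fun _ => by ext; simp) (fun _ => by ext; simp)

/-- Every algebra isomorphic to a Hopf algebra is one, such that the isomorphism respects the Hopf
algebra structures. -/
theorem RingEquiv.exists_hopfAlgebra {k A B : Type*} [Field k] [CommRing A] [HopfAlgebra k A]
    [CommRing B] (e : A ≃+* B) : ∃ _ : HopfAlgebra k B, Nonempty (A ≃ₐc[k] B) := by
  -- A `HopfAlgebra` structure includes the scalar action, so the latter is transported as well and
  -- a ring isomorphism suffices.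
  let : Algebra k B := ((e : A →+* B).comp (algebraMap k A)).toAlgebra
  let e' : A ≃ₐ[k] B := AlgEquiv.ofRingEquiv (f := e) fun _ => rfl
  refine ⟨e'.hopfAlgebra, ⟨@BialgEquiv.ofAlgEquiv k A B _ _ _ _ e'.hopfAlgebra.toBialgebra e'
    ?_ ?_⟩⟩
  · apply AlgHom.ext fun a => ?_
    exact congrArg (Bialgebra.counitAlgHom k A) (e'.symm_apply_apply a)
  · apply AlgHom.ext fun a => ?_
    exact congrArg (fun a => Algebra.TensorProduct.map (e' : A →ₐ[k] B) (e' : A →ₐ[k] B)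
      (Bialgebra.comulAlgHom k A a)) (e'.symm_apply_apply a).symm

end Transport

namespace ProalgGroup

/-- Up to isomorphism, there is only a set of algebraic groups. -/
theorem exists_small_algebraic (k : Type u) [Field k] : ∃ (T : Type u) (F : T → ProalgGroup k),
    ∀ G : ProalgGroup k, G.IsAlgebraic → ∃ t, Nonempty (G.coord ≃ₐc[k] (F t).coord) := by
  -- A finite type algebra is a quotient of a polynomial ring in `n` variables; the ideals and the
  -- Hopf structures on the quotients form a type in `Type u`, over which products can be taken.
  refine ⟨Σ (n : ℕ) (I : Ideal (MvPolynomial (Fin n) k)),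
    HopfAlgebra k (MvPolynomial (Fin n) k ⧸ I), fun t => @mk k _ _ _ t.2.2, fun G hG => ?_⟩
  obtain ⟨n, f, hf⟩ := Algebra.FiniteType.iff_quotient_mvPolynomial''.1 hG
  obtain ⟨h, e⟩ := (Ideal.quotientKerAlgEquivOfSurjective hf).symm.toRingEquiv.exists_hopfAlgebra (k := k)
  exact ⟨⟨n, RingHom.ker f, h⟩, e⟩

end ProalgGroup
end

/-! ### Points, images, equalizers and kernels -/

noncomputable section

namespace ProalgGroup

variable {k : Type u} [Field k] {G H K : ProalgGroup k}

section Points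

variable {S : Type*} [CommRing S] [Algebra k S]

theorem Points.ext {g h : G.Points S} (w : ∀ a, g.eval a = h.eval a) : g = h :=
  WithConv.ofConv_injective (AlgHom.ext w)

theorem Points.one_eval (a : G.coord) :
    (1 : G.Points S).eval a = algebraMap k S (Coalgebra.counit a) := rfl

theorem Hom.onPoints_eval (f : Hom G H) (g : G.Points S) (a : H.coord) :
    (f.onPoints g).eval a = g.eval (f.dual a) := rfl

theorem Hom.onPoints_one (f : Hom G H) : f.onPoints (1 : G.Points S) = 1 :=
  Points.ext fun a => congrArg (algebraMap k S) (CoalgHomClass.counit_comp_apply f.dual a)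

theorem Hom.onPoints_mul (f : Hom G H) (g h : G.Points S) :
    f.onPoints (g * h) = f.onPoints g * f.onPoints h :=
  WithConv.ofConv_injective (AlgHom.convMul_comp_bialgHom_distrib g h f.dual)

/-- The map induced on points is a group homomorphism. -/
def Hom.onPointsHom (f : Hom G H) (S : Type*) [CommRing S] [Algebra k S] :
    G.Points S →* H.Points S where
  toFun := f.onPoints
  map_one' := f.onPoints_one
  map_mul' := f.onPoints_mul

theorem Hom.onPoints_comp (f : Hom H K) (g : Hom G H) (x : G.Points S) :
    (f.comp g).onPoints x = f.onPoints (g.onPoints x) := rfl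

end Points

theorem Hom.ext_dual {f g : Hom G H} (h : ∀ a, f.dual a = g.dual a) : f = g :=
  Hom.ext (BialgHom.ext h)

theorem Hom.IsEpi.comp {f : Hom H K} {g : Hom G H} (hf : f.IsEpi) (hg : g.IsEpi) :
    (f.comp g).IsEpi :=
  Function.Injective.comp (g := g.dual) (f := f.dual) hg hf

theorem Hom.isIso_of_bijective (f : Hom G H) (hf : Function.Bijective f.dual) : f.IsIso := by
  let e := BialgEquiv.ofBijective f.dual hf
  exact ⟨⟨(e.symm : G.coord →ₐc[k] H.coord)⟩,
    Hom.ext_dual fun a => e.apply_symm_apply a, Hom.ext_dual fun a => e.symm_apply_apply a⟩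

namespace ClosedSubgroup

/-- The preimage of a closed subgroup. -/
def comap (f : Hom G H) (N : ClosedSubgroup H) : ClosedSubgroup G where
  ideal := N.ideal.map f.dual
  isHopfIdeal := N.isHopfIdeal.map f.dual

theorem mem_comap_points {f : Hom G H} {N : ClosedSubgroup H} {S : Type*} [CommRing S]
    [Algebra k S] {g : G.Points S} : g ∈ (comap f N).points S ↔ f.onPoints g ∈ N.points S := by
  refine ⟨fun h a ha => h _ (Ideal.mem_map_of_mem f.dual ha), fun h => ?_⟩
  have : N.ideal.map f.dual ≤ RingHom.ker g.eval := Ideal.map_le_iff_le_comap.2 h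
  exact this

end ClosedSubgroup

/-- The (scheme-theoretic) image of a morphism. -/
def Hom.range (f : Hom G H) : ClosedSubgroup H where
  ideal := RingHom.ker f.dual
  isHopfIdeal := f.dual.isHopfIdeal_ker

/-- The closed subgroup on which two morphisms agree. -/
def Hom.equalizer (f g : Hom G H) : ClosedSubgroup G where
  ideal := Ideal.span (Set.range fun a => f.dual a - g.dual a)
  isHopfIdeal := f.dual.isHopfIdeal_span_sub g.dual

theorem Hom.mem_equalizer_points {f g : Hom G H} {S : Type*} [CommRing S] [Algebra k S]
    {x : G.Points S} (h : f.onPoints x = g.onPoints x) : x ∈ (f.equalizer g).points S := by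
  have : (f.equalizer g).ideal ≤ RingHom.ker x.eval := by
    refine Ideal.span_le.2 ?_
    rintro _ ⟨a, rfl⟩
    change x.eval (f.dual a - g.dual a) = 0
    rw [map_sub, sub_eq_zero]
    exact congrArg (fun y => Points.eval y a) h
  exact this

/-- The trivial subgroup. -/
def ClosedSubgroup.trivial (G : ProalgGroup k) : ClosedSubgroup G where
  ideal := RingHom.ker (Bialgebra.counitBialgHom k G.coord)
  isHopfIdeal := (Bialgebra.counitBialgHom k G.coord).isHopfIdeal_ker

theorem ClosedSubgroup.mem_trivial_points {S : Type*} [CommRing S] [Algebra k S]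
    {x : G.Points S} : x ∈ (ClosedSubgroup.trivial G).points S ↔ x = 1 := by
  constructor
  · refine fun h => Points.ext fun a => ?_
    have h1 : a - algebraMap k _ (Coalgebra.counit a) ∈ (ClosedSubgroup.trivial G).ideal := by
      change Bialgebra.counitBialgHom k G.coord _ = 0
      simp
    have h2 := h _ h1
    rw [map_sub, sub_eq_zero, AlgHom.commutes] at h2
    exact h2
  · rintro rfl a ha
    have ha : Coalgebra.counit (R := k) a = 0 := ha
    rw [Points.one_eval, ha, map_zero]

/-- The kernel of a morphism. -/
def Hom.ker (f : Hom G H) : ClosedSubgroup G := (ClosedSubgroup.trivial H).comap f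

theorem Hom.mem_ker_points {f : Hom G H} {S : Type*} [CommRing S] [Algebra k S]
    {x : G.Points S} : x ∈ f.ker.points S ↔ f.onPoints x = 1 :=
  ClosedSubgroup.mem_comap_points.trans ClosedSubgroup.mem_trivial_points

theorem Hom.IsEpi.isCoalgebraic_ker {f : Hom G H} (hf : f.IsEpi) (hH : H.IsAlgebraic) :
    f.ker.IsCoalgebraic := by
  refine ⟨fun S _ _ g n hn => ?_, H, f, ⟨hf, fun S _ _ g => Hom.mem_ker_points⟩, hH⟩
  rw [Hom.mem_ker_points] at hn ⊢
  have : f.onPointsHom S (g * n * g⁻¹) = 1 := by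
    rw [map_mul, map_mul, show f.onPointsHom S n = 1 from hn, mul_one, ← map_mul, mul_inv_cancel,
      map_one]
  exact this

/-! ### Generating families of points -/

section Generates

variable {R : Type u} [CommRing R] [Algebra k R] {X : Type u} {φ : X → G.Points R}

/-- The ideal of an intersection is the sum of the ideals, and a sum is zero exactly when every
summand is. -/
theorem generates_iff :
    Generates φ ↔ ∀ N : ClosedSubgroup G, (∀ x, φ x ∈ N.points R) → N.ideal = ⊥ := by
  have htop : (⊤ : ClosedSubgroup G).ideal = ⊥ := rfl
  rw [Generates, ClosedSubgroup.ext_iff, htop, ClosedSubgroup.generatedBy, iSup₂_eq_bot]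
  simp only [Set.mem_ofPred_eq, Set.range_subset_iff]

theorem Generates.map (h : Generates φ) {f : Hom G H} (hf : f.IsEpi) :
    Generates fun x => f.onPoints (φ x) := by
  rw [generates_iff] at h ⊢
  intro N hN
  have h1 : N.ideal.map f.dual = ⊥ := h (N.comap f) fun x => ClosedSubgroup.mem_comap_points.2 (hN x)
  exact (Ideal.map_eq_bot_iff_of_injective hf).1 h1

/-- The equalizer is a closed subgroup containing the generating points, hence everything. -/
theorem Generates.hom_ext (h : Generates φ) {f g : Hom G H}
    (hfg : ∀ x, f.onPoints (φ x) = g.onPoints (φ x)) : f = g := by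
  have h1 := generates_iff.1 h (f.equalizer g) fun x => Hom.mem_equalizer_points (hfg x)
  refine Hom.ext_dual fun a => sub_eq_zero.1 ?_
  have h2 : f.dual a - g.dual a ∈ (f.equalizer g).ideal := Ideal.subset_span ⟨a, rfl⟩
  rwa [h1] at h2

/-- The scheme-theoretic image contains the generating points, hence is `H`. -/
theorem Generates.isEpi {φ : X → H.Points R} (h : Generates φ) {f : Hom G H} {ι : X → G.Points R}
    (hf : ∀ x, f.onPoints (ι x) = φ x) : f.IsEpi := by
  have h1 : RingHom.ker f.dual = ⊥ := generates_iff.1 h f.range fun x a ha => by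
    rw [← hf, Hom.onPoints_eval, show f.dual a = 0 from ha, map_zero]
  exact (RingHom.injective_iff_ker_eq_bot f.dual).2 h1

/-- The point of a closed subgroup given by a point of the ambient group. -/
def ClosedSubgroup.liftPoint (N : ClosedSubgroup G) {x : G.Points R} (hx : x ∈ N.points R) :
    N.toProalgGroup.Points R :=
  haveI := N.isHopfIdeal
  WithConv.toConv (Ideal.Quotient.liftₐ N.ideal x.eval hx : G.coord ⧸ N.ideal →ₐ[k] R)

theorem ClosedSubgroup.incl_dual_surjective (N : ClosedSubgroup G) :
    Function.Surjective N.incl.dual :=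
  Ideal.Quotient.mk_surjective

theorem ClosedSubgroup.ker_incl_dual (N : ClosedSubgroup G) :
    RingHom.ker N.incl.dual = N.ideal :=
  Ideal.mk_ker

theorem ClosedSubgroup.mem_generatedBy_points (x : X) :
    φ x ∈ (generatedBy (Set.range φ)).points R := by
  have : (generatedBy (Set.range φ)).ideal ≤ RingHom.ker (φ x).eval :=
    iSup₂_le fun N hN a ha => hN ⟨x, rfl⟩ a ha
  exact this

/-- The points `φ x`, as points of the closed subgroup that they generate. -/
def toGeneratedBy (φ : X → G.Points R) (x : X) :
    (ClosedSubgroup.generatedBy (Set.range φ)).toProalgGroup.Points R :=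
  ClosedSubgroup.liftPoint _ (ClosedSubgroup.mem_generatedBy_points (φ := φ) x)

theorem generates_toGeneratedBy (φ : X → G.Points R) : Generates (toGeneratedBy φ) := by
  rw [generates_iff]
  intro N hN
  let M := ClosedSubgroup.generatedBy (Set.range φ)
  -- `P` is `N` viewed as a closed subgroup of `G`. It contains all `φ x`, so by minimality it
  -- contains `M`.
  let P := (M.incl.comp N.incl).range
  have h1 : P.ideal ≤ M.ideal := by
    refine le_iSup₂_of_le (f := fun (H : ClosedSubgroup G)
        (_ : H ∈ {H : ClosedSubgroup G | Set.range φ ⊆ H.points R}) => H.ideal) P ?_ le_rfl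
    rintro _ ⟨x, rfl⟩ a ha
    refine hN x (M.incl.dual a) ?_
    rw [← N.ker_incl_dual]
    exact ha
  refine eq_bot_iff.2 fun b hb => ?_
  obtain ⟨a, rfl⟩ := M.incl_dual_surjective b
  refine RingHom.mem_ker.1 (?_ : a ∈ RingHom.ker M.incl.dual)
  rw [M.ker_incl_dual]
  refine h1 ?_
  rw [← N.ker_incl_dual] at hb
  exact hb

end Generates

end ProalgGroup
end

/-! ### Quotients in a formation and projective limits -/

noncomputable section

theorem BialgHom.exists_comp_eq_of_ker_le {k A B D : Type*} [CommRing k] [CommRing A] [CommRing B]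
    [CommRing D] [Bialgebra k A] [Bialgebra k B] [Bialgebra k D] (f : A →ₐc[k] D) (π : A →ₐc[k] B)
    (hπ : Function.Surjective π) (h : RingHom.ker π ≤ RingHom.ker f) :
    ∃ e : B →ₐc[k] D, e.comp π = f := by
  let e : B →ₐ[k] D := AlgHom.liftOfSurjective (π : A →ₐ[k] B) hπ (f : A →ₐ[k] D) h
  have he : ∀ a, e (π a) = f a := fun a =>
    AlgHom.liftOfSurjective_apply (π : A →ₐ[k] B) hπ (f : A →ₐ[k] D) h a
  have he' : e.comp (π : A →ₐ[k] B) = f := AlgHom.ext he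
  refine ⟨.ofAlgHom e ?_ ?_, BialgHom.ext he⟩
  · refine (AlgHom.cancel_right (f := (π : A →ₐ[k] B)) hπ).1 ?_
    rw [AlgHom.comp_assoc, he', BialgHom.counitAlgHom_comp, BialgHom.counitAlgHom_comp]
  · refine (AlgHom.cancel_right (f := (π : A →ₐ[k] B)) hπ).1 ?_
    rw [AlgHom.comp_assoc, AlgHom.comp_assoc, he', ← BialgHom.map_comp_comulAlgHom,
      ← BialgHom.map_comp_comulAlgHom, ← AlgHom.comp_assoc, ← Algebra.TensorProduct.map_comp, he']

/-- The algebras of a directed system with injective transition maps embed compatibly into a common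
algebra. -/
theorem Algebra.exists_injective_cocone {k I : Type u} [CommRing k] [Preorder I] [Nonempty I]
    [IsDirectedOrder I] (A : I → Type u) [∀ i, CommRing (A i)] [∀ i, Algebra k (A i)]
    (f : ∀ i j, i ≤ j → A i →ₐ[k] A j) (hid : ∀ i a, f i i le_rfl a = a)
    (hcomp : ∀ i j l (hij : i ≤ j) (hjl : j ≤ l) a, f j l hjl (f i j hij a) = f i l (hij.trans hjl) a)
    (hinj : ∀ i j hij, Function.Injective (f i j hij)) :
    ∃ (S : Type u) (_ : CommRing S) (_ : Algebra k S) (o : ∀ i, A i →ₐ[k] S),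
      (∀ i j hij a, o j (f i j hij a) = o i a) ∧ ∀ i, Function.Injective (o i) := by
  have : DirectedSystem A fun i j h => (f i j h : A i →+* A j) :=
    { map_self := fun i a => hid i a
      map_map := fun _ _ _ hij hjl a => hcomp _ _ _ hij hjl a }
  let o (i : I) : A i →+* Ring.DirectLimit A fun i j h => (f i j h : A i →+* A j) :=
    Ring.DirectLimit.of _ _ i
  have ho : ∀ i j (hij : i ≤ j) a, o j (f i j hij a) = o i a := fun i j hij a =>
    Ring.DirectLimit.of_f (f := fun i j h => (f i j h : A i →+* A j)) hij a
  obtain ⟨i₀⟩ := ‹Nonempty I›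
  -- The scalars act through the arbitrary index `i₀`; by directedness any other index gives the
  -- same action.
  refine ⟨_, inferInstance, ((o i₀).comp (algebraMap k _)).toAlgebra,
    fun j => @AlgHom.mk _ _ _ _ _ _ _ (_) (o j) fun c => ?_, ho,
    fun i => Ring.DirectLimit.of_injective (fun i j h => (f i j h : A i →+* A j)) hinj i⟩
  obtain ⟨l, hil, hjl⟩ := exists_ge_ge i₀ j
  change o j (algebraMap k _ c) = o i₀ (algebraMap k _ c)
  rw [← ho i₀ l hil, ← ho j l hjl, AlgHom.commutes, AlgHom.commutes]

namespace ProalgGroup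

variable {k : Type u} [Field k] {G H : ProalgGroup k}

theorem Hom.IsEpi.cancel {K : ProalgGroup k} {p : Hom G H} (hp : p.IsEpi) {f g : Hom H K}
    (h : f.comp p = g.comp p) : f = g :=
  Hom.ext_dual fun a => hp (congrArg (fun q : Hom G K => q.dual a) h)

theorem Hom.IsEpi.of_comp {K : ProalgGroup k} {f : Hom H K} {g : Hom G H} (h : (f.comp g).IsEpi) :
    f.IsEpi :=
  Function.Injective.of_comp (f := g.dual) (g := f.dual) h

/-- A morphism is an epimorphism onto its image. -/
theorem Hom.exists_rangeLift (f : Hom G H) :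
    ∃ g : Hom G f.range.toProalgGroup, g.IsEpi ∧ f.range.incl.comp g = f := by
  obtain ⟨e, he⟩ := f.dual.exists_comp_eq_of_ker_le f.range.incl.dual
    f.range.incl_dual_surjective f.range.ker_incl_dual.le
  refine ⟨⟨e⟩, ?_, Hom.ext he⟩
  refine (injective_iff_map_eq_zero e).2 fun b hb => ?_
  obtain ⟨a, rfl⟩ := f.range.incl_dual_surjective b
  have h1 : a ∈ RingHom.ker f.range.incl.dual := by
    rw [ClosedSubgroup.ker_incl_dual]
    exact (BialgHom.congr_fun he a).symm.trans hb
  exact h1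

/-- The image of `k[H]` in `k[G]`. -/
abbrev Hom.dualRange (f : Hom G H) : Subalgebra k G.coord := (f.dual : H.coord →ₐ[k] G.coord).range

section Join

variable {F₁ F₂ : ProalgGroup k}

/-- The morphism to a product with given components. -/
def Hom.prodLift (p₁ : Hom G F₁) (p₂ : Hom G F₂) : Hom G (F₁.prod F₂) where
  dual := (Bialgebra.mulBialgHom k G.coord).comp (Bialgebra.TensorProduct.map p₁.dual p₂.dual)

theorem Hom.prodLift_dual_tmul (p₁ : Hom G F₁) (p₂ : Hom G F₂) (a : F₁.coord) (b : F₂.coord) :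
    (p₁.prodLift p₂).dual (a ⊗ₜ b) = p₁.dual a * p₂.dual b := rfl

theorem Hom.fst_comp_prodLift (p₁ : Hom G F₁) (p₂ : Hom G F₂) :
    (fst F₁ F₂).comp (p₁.prodLift p₂) = p₁ := by
  refine Hom.ext_dual fun a => ?_
  have h : (fst F₁ F₂).dual a = a ⊗ₜ[k] (1 : F₂.coord) :=
    congrArg (fun b => a ⊗ₜ[k] b) (map_one (algebraMap k F₂.coord))
  change (p₁.prodLift p₂).dual ((fst F₁ F₂).dual a) = _
  rw [h, Hom.prodLift_dual_tmul, map_one, mul_one]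

theorem Hom.snd_comp_prodLift (p₁ : Hom G F₁) (p₂ : Hom G F₂) :
    (snd F₁ F₂).comp (p₁.prodLift p₂) = p₂ := by
  refine Hom.ext_dual fun b => ?_
  have h : (snd F₁ F₂).dual b = (1 : F₁.coord) ⊗ₜ[k] b :=
    congrArg (fun a => a ⊗ₜ[k] b) (map_one (algebraMap k F₁.coord))
  change (p₁.prodLift p₂).dual ((snd F₁ F₂).dual b) = _
  rw [h, Hom.prodLift_dual_tmul, map_one, one_mul]

theorem Hom.dualRange_prodLift (p₁ : Hom G F₁) (p₂ : Hom G F₂) :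
    (p₁.prodLift p₂).dualRange = p₁.dualRange ⊔ p₂.dualRange := by
  rw [← Algebra.TensorProduct.productMap_range]
  refine congrArg AlgHom.range (Algebra.TensorProduct.ext' fun a b => ?_)
  rw [Algebra.TensorProduct.productMap_apply_tmul]
  rfl

variable {C : ProalgGroup k → Prop} (hC : IsFormation C)

include hC in
-- The image of `G` in `F₁ × F₂` is a subdirect product, hence in `C`; its coordinate ring is the
-- subalgebra generated by those of `F₁` and `F₂`.
theorem IsFormation.exists_sup (h₁ : C F₁) (h₂ : C F₂) {p₁ : Hom G F₁} {p₂ : Hom G F₂}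
    (hp₁ : p₁.IsEpi) (hp₂ : p₂.IsEpi) : ∃ (F : ProalgGroup k) (p : Hom G F),
      C F ∧ p.IsEpi ∧ p.dualRange = p₁.dualRange ⊔ p₂.dualRange := by
  obtain ⟨g, hg, hgq⟩ := (p₁.prodLift p₂).exists_rangeLift
  refine ⟨_, g, hC.subdirect F₁ F₂ _ h₁ h₂ (.of_comp (g := g) ?_) (.of_comp (g := g) ?_), hg, ?_⟩
  · have : ((fst F₁ F₂).comp (p₁.prodLift p₂).range.incl).comp g = p₁ := by
      refine Eq.trans ?_ (p₁.fst_comp_prodLift p₂)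
      exact congrArg (fst F₁ F₂).comp hgq
    rwa [this]
  · have : ((snd F₁ F₂).comp (p₁.prodLift p₂).range.incl).comp g = p₂ := by
      refine Eq.trans ?_ (p₁.snd_comp_prodLift p₂)
      exact congrArg (snd F₁ F₂).comp hgq
    rwa [this]
  · rw [← Hom.dualRange_prodLift]
    apply SetLike.coe_injective
    rw [AlgHom.coe_range, AlgHom.coe_range]
    have h : ∀ a, g.dual ((p₁.prodLift p₂).range.incl.dual a) = (p₁.prodLift p₂).dual a :=
      fun a => congrArg (fun q : Hom G (F₁.prod F₂) => q.dual a) hgq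
    ext b
    constructor
    · rintro ⟨c, rfl⟩
      obtain ⟨a, rfl⟩ := (p₁.prodLift p₂).range.incl_dual_surjective c
      exact ⟨a, (h a).symm⟩
    · rintro ⟨a, rfl⟩
      exact ⟨_, h a⟩

include hC in
-- The trivial group is a quotient of every group, so it lies in `C`. This keeps the index set in
-- `IsFormation.isPro` nonempty.
theorem IsFormation.exists_epi (G : ProalgGroup k) :
    ∃ (F : ProalgGroup k) (p : Hom G F), C F ∧ p.IsEpi := by
  obtain ⟨G₀, h₀, -⟩ := hC.nontrivial
  have h : ∀ G' : ProalgGroup k, Hom.IsEpi (G := G') (H := ⟨k⟩)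
      ⟨Bialgebra.unitBialgHom k G'.coord⟩ := fun G' => Bialgebra.algebraMap_injective G'.coord
  exact ⟨⟨k⟩, _, hC.quotient G₀ _ _ (inferInstanceAs (Algebra.FiniteType k k)) (h G₀) h₀, h G⟩

end Join

section Limit

variable {I : Type u} [Preorder I] {F : I → ProalgGroup k}
  {t : ∀ {i j : I}, i ≤ j → Hom (F j) (F i)} {p : ∀ i, Hom G (F i)}

/-- Let `B` be the subalgebra generated by the images. The maps `k[F i] → B` form a compatible
family, which gives `k[G] → B`; followed by the inclusion it is the identity, by uniqueness of
lifts, so `B` is all of `k[G]`. -/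
theorem IsProjLimit.iSup_dualRange (h : IsProjLimit F t G p) : ⨆ i, (p i).dualRange = ⊤ := by
  set B := ⨆ i, (p i).dualRange with hB
  have hle : ∀ i, (p i).dualRange ≤ B := le_iSup fun i => (p i).dualRange
  let g : ∀ i, (F i).Points B := fun i => WithConv.toConv
    (((p i).dual : (F i).coord →ₐ[k] G.coord).codRestrict B fun a => hle i ⟨a, rfl⟩)
  have hg : ∀ (i j : I) (h : i ≤ j), (t h).onPoints (g j) = g i := fun i j hij =>
    Points.ext fun a => Subtype.ext (congrArg (fun q : Hom G (F i) => q.dual a) (h.1 i j hij))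
  obtain ⟨x, hx, -⟩ := h.2 B g hg
  let y : G.Points G.coord := WithConv.toConv (B.val.comp x.eval)
  let y' : G.Points G.coord := WithConv.toConv (AlgHom.id k _)
  obtain ⟨z, -, hz⟩ := h.2 G.coord
    (fun i => WithConv.toConv ((p i).dual : (F i).coord →ₐ[k] G.coord))
    fun i j hij => Points.ext fun a => congrArg (fun q : Hom G (F i) => q.dual a) (h.1 i j hij)
  have h1 : y = z := hz y fun i => Points.ext fun a =>
    congrArg (fun w : (F i).Points B => (w.eval a : G.coord)) (hx i)
  have h2 : y' = z := hz y' fun i => rfl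
  refine eq_top_iff.2 fun a _ => ?_
  have h3 : y.eval a = y'.eval a := by rw [h1, h2]
  have h4 : (x.eval a : G.coord) = a := h3
  exact h4 ▸ (x.eval a).2

theorem IsProjLimit.isEpi [Nonempty I] [IsDirectedOrder I] (h : IsProjLimit F t G p)
    (hid : ∀ i, t (le_refl i) = Hom.id (F i))
    (hcomp : ∀ (i j l : I) (hij : i ≤ j) (hjl : j ≤ l),
      (t hij).comp (t hjl) = t (hij.trans hjl))
    (hepi : ∀ (i j : I) (h : i ≤ j), (t h).IsEpi) (i : I) : (p i).IsEpi := by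
  -- The injections of the `k[F i]` into a common algebra `S` form a compatible family of
  -- `S`-points. They factor through `k[G]`, which forces `k[F i] → k[G]` to be injective.
  obtain ⟨S, _, _, o, ho, hinj⟩ := Algebra.exists_injective_cocone (fun i => (F i).coord)
    (fun i j hij => ((t hij).dual : (F i).coord →ₐ[k] (F j).coord))
    (fun i a => congrArg (fun q : Hom (F i) (F i) => q.dual a) (hid i))
    (fun i j l hij hjl a => congrArg (fun q : Hom (F l) (F i) => q.dual a) (hcomp i j l hij hjl))
    hepi
  obtain ⟨x, hx, -⟩ := h.2 S (fun j => WithConv.toConv (o j))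
    fun i j hij => Points.ext fun a => ho i j hij a
  have hcomp' : ∀ a, x.eval ((p i).dual a) = o i a := fun a =>
    congrArg (fun w : (F i).Points S => w.eval a) (hx i)
  exact fun a b hab => hinj i (by rw [← hcomp', ← hcomp', hab])

end Limit

/-- A proalgebraic group is a pro-`C`-group if its coordinate ring is generated by the coordinate
rings of quotients in `C`. -/
theorem IsFormation.isPro {C : ProalgGroup k → Prop} (hC : IsFormation C)
    {J : Type*} {F₀ : J → ProalgGroup k} (hF₀ : ∀ j, C (F₀ j)) {p₀ : ∀ j, Hom G (F₀ j)}
    (hp₀ : ∀ j, (p₀ j).IsEpi) (hsup : ⨆ j, (p₀ j).dualRange = ⊤) : IsPro C G := by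
  -- Indexing by subalgebras of `k[G]` instead of by quotients gives a partial order by inclusion,
  -- in the right universe.
  let I := {S : Subalgebra k G.coord // ∃ (F : ProalgGroup k) (p : Hom G F),
    C F ∧ p.IsEpi ∧ p.dualRange = S}
  choose F p hF hp hrange using fun i : I => i.2
  have hne : Nonempty I := by
    obtain ⟨F, p, h1, h2⟩ := hC.exists_epi G
    exact ⟨⟨_, F, p, h1, h2, rfl⟩⟩
  have hdir : IsDirectedOrder I := ⟨fun i j => by
    obtain ⟨F', p', h1, h2, h3⟩ := hC.exists_sup (hF i) (hF j) (hp i) (hp j)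
    refine ⟨⟨_, F', p', h1, h2, rfl⟩, ?_, ?_⟩
    · change i.1 ≤ p'.dualRange
      rw [h3, hrange, hrange]
      exact le_sup_left
    · change j.1 ≤ p'.dualRange
      rw [h3, hrange, hrange]
      exact le_sup_right⟩
  -- Inclusion of subalgebras yields the transition maps; since `p j` is an epimorphism they are
  -- unique, whence functoriality.
  have ht : ∀ {i j : I}, i ≤ j → ∃ t : Hom (F j) (F i), t.comp (p j) = p i := fun {i j} hij => by
    obtain ⟨e, he⟩ := (p i).dual.exists_comp_eq_of_range_le (p j).dual (hp j)
      ((hrange i).le.trans (le_trans hij (hrange j).ge))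
    exact ⟨⟨e⟩, Hom.ext he⟩
  choose t ht using @ht
  have hsup' : ⨆ i, (p i).dualRange = ⊤ := by
    refine eq_top_iff.2 (hsup ▸ iSup_le fun j => ?_)
    refine le_iSup_of_le (f := fun i => (p i).dualRange)
      (⟨_, F₀ j, p₀ j, hF₀ j, hp₀ j, rfl⟩ : I) ?_
    rw [hrange]
  refine ⟨I, inferInstance, hne, hdir, F, t, p, hF, fun i => (hp i).cancel (ht _),
    fun i j l hij hjl => (hp l).cancel ?_,
    fun i j h => Hom.IsEpi.of_comp (g := p j) ((ht h).symm ▸ hp i), fun i j h => ht h, ?_⟩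
  · rw [ht]
    refine Eq.trans ?_ (ht hij)
    exact congrArg (t hij).comp (ht hjl)
  · intro S _ _ g hg
    let e : ∀ i, (F i).coord ≃ₐ[k] (p i).dualRange := fun i =>
      AlgEquiv.ofInjective ((p i).dual : (F i).coord →ₐ[k] G.coord) (hp i)
    have he : ∀ i a, (e i a : G.coord) = (p i).dual a := fun i a => rfl
    have hmono : ∀ {i j : I}, i ≤ j → (p i).dualRange ≤ (p j).dualRange := fun {i j} hij =>
      (hrange i).le.trans (le_trans hij (hrange j).ge)
    -- `k[G]` is the directed union of the images of the `k[F i]`, so compatible homomorphisms on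
    -- these glue.
    let x : (⊤ : Subalgebra k G.coord) →ₐ[k] S := Subalgebra.iSupLift (fun i => (p i).dualRange)
      (fun i j => by
        obtain ⟨l, hil, hjl⟩ := exists_ge_ge i j
        exact ⟨l, hmono hil, hmono hjl⟩)
      (fun i => (g i).eval.comp (e i).symm)
      (fun i j hij => AlgHom.ext fun b => by
        obtain ⟨a, rfl⟩ := (e i).surjective b
        have hij' : i ≤ j := (hrange i).ge.trans (hij.trans (hrange j).le)
        have h1 : e j ((t hij').dual a) = Subalgebra.inclusion hij (e i a) :=
          Subtype.ext (congrArg (fun q : Hom G (F i) => q.dual a) (ht hij'))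
        have h2 : (g j).eval ((t hij').dual a) = (g i).eval a :=
          congrArg (fun w : (F i).Points S => w.eval a) (hg i j hij')
        change (g i).eval ((e i).symm (e i a)) =
          (g j).eval ((e j).symm (Subalgebra.inclusion hij (e i a)))
        rw [← h1, AlgEquiv.symm_apply_apply, AlgEquiv.symm_apply_apply, h2])
      ⊤ hsup'.ge
    have hx : ∀ i a, x ⟨(p i).dual a, trivial⟩ = (g i).eval a := fun i a => by
      refine (Subalgebra.iSupLift_mk (K := fun i => (p i).dualRange) (T := ⊤) (e i a)
        Algebra.mem_top).trans ?_
      change (g i).eval ((e i).symm (e i a)) = _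
      rw [AlgEquiv.symm_apply_apply]
    let y : G.Points S := WithConv.toConv
      (x.comp ((Subalgebra.topEquiv (R := k) (A := G.coord)).symm : G.coord →ₐ[k] _))
    refine ⟨y, fun i => Points.ext fun a => hx i a, fun y hy => WithConv.ofConv_injective ?_⟩
    refine AlgHom.ext_of_iSup_range hsup' fun i => AlgHom.ext fun a => ?_
    refine Eq.trans ?_ (hx i a).symm
    exact congrArg (fun w : (F i).Points S => w.eval a) (hy i)

end ProalgGroup
end

/-! ### Convergence to `1` -/

noncomputable section

namespace ProalgGroup

section Convergence

variable {k : Type u} [Field k] {G : ProalgGroup k} {R : Type u} [CommRing R] [Algebra k R]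
  {X : Type u} {φ : X → G.Points R}

/-- The functions on `G` that agree at almost all points of a family with their value at `1`. -/
def almostConstant (φ : X → G.Points R) : Subalgebra k G.coord where
  carrier := {a | {x | (φ x).eval a ≠ algebraMap k R (Coalgebra.counit a)}.Finite}
  mul_mem' {a b} ha hb := (ha.union hb).subset fun x hx => by
    by_contra h
    rw [Set.mem_union, not_or] at h
    refine hx ?_
    rw [map_mul, not_not.1 h.1, not_not.1 h.2, Bialgebra.counit_mul, map_mul]
  add_mem' {a b} ha hb := (ha.union hb).subset fun x hx => by
    by_contra h
    rw [Set.mem_union, not_or] at h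
    refine hx ?_
    rw [map_add, not_not.1 h.1, not_not.1 h.2, map_add, map_add]
  algebraMap_mem' c := by
    refine Set.finite_empty.subset fun x hx => (hx ?_).elim
    rw [AlgHom.commutes, Bialgebra.counit_algebraMap]

/-- `almostConstant φ` is a subalgebra containing every `k[F j]`, hence all of `k[G]`. As `k[G/N]`
is finitely generated, only the finitely many exceptional points of each generator can lie outside
`N`. -/
theorem convergesToOne_of_iSup {J : Type*} {F : J → ProalgGroup k} (q : ∀ j, Hom G (F j))
    (hq : ⨆ j, (q j).dualRange = ⊤) (h : ∀ j, {x | (q j).onPoints (φ x) ≠ 1}.Finite) :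
    ConvergesToOne φ := by
  have htop : almostConstant φ = ⊤ := by
    refine eq_top_iff.2 (hq ▸ iSup_le fun j => ?_)
    rintro _ ⟨a, rfl⟩
    refine (h j).subset fun x hx hx' => hx ?_
    have h1 : (φ x).eval ((q j).dual a) = algebraMap k R (Coalgebra.counit a) :=
      congrArg (fun w : (F j).Points R => w.eval a) hx'
    exact h1.trans (congrArg _ (CoalgHomClass.counit_comp_apply (q j).dual a).symm)
  rintro N ⟨-, Q, π, hπ, hQ⟩
  obtain ⟨s, hs⟩ := hQ.out
  refine (Set.Finite.biUnion s.finite_toSet fun b _ =>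
    (htop ▸ trivial : π.dual b ∈ almostConstant φ)).subset fun x hx => ?_
  by_contra h'
  simp only [Set.mem_iUnion, not_exists] at h'
  refine hx ((hπ.2 R (φ x)).2 (WithConv.ofConv_injective ?_))
  refine AlgHom.ext_of_adjoin_eq_top hs fun b hb => ?_
  refine (not_not.1 (h' b hb)).trans ?_
  exact congrArg (algebraMap k R) (CoalgHomClass.counit_comp_apply π.dual b)

theorem ConvergesToOne.finite (h : ConvergesToOne φ) {H : ProalgGroup k} {f : Hom G H}
    (hf : f.IsEpi) (hH : H.IsAlgebraic) : {x | f.onPoints (φ x) ≠ 1}.Finite :=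
  (h f.ker (hf.isCoalgebraic_ker hH)).subset fun _ hx hx' => hx (Hom.mem_ker_points.1 hx')

end Convergence

/-! ### Products, and morphisms into projective limits -/

section Free

variable {k : Type u} [Field k]

/-- The product of a family of proalgebraic groups. -/
def pi {J : Type u} (F : J → ProalgGroup k) : ProalgGroup k where
  coord := AlgCoproduct (fun j => (F j).coord) k

variable {J : Type u} {F : J → ProalgGroup k}

/-- The projections of a product. -/
def piProj (j : J) : Hom (pi F) (F j) where
  dual := AlgCoproduct.inclBialgHom (fun j => (F j).coord) j

/-- The point of a product with given components. -/
def piPoint {R : Type u} [CommRing R] [Algebra k R] (g : ∀ j, (F j).Points R) : (pi F).Points R :=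
  WithConv.toConv (AlgCoproduct.lift fun j => (g j).eval)

theorem piProj_onPoints_piPoint {R : Type u} [CommRing R] [Algebra k R]
    (g : ∀ j, (F j).Points R) (j : J) : (piProj j).onPoints (piPoint g) = g j :=
  WithConv.ofConv_injective (AlgCoproduct.lift_comp_incl (fun j => (g j).eval) j)

theorem iSup_dualRange_piProj : ⨆ j, (piProj (F := F) j).dualRange = ⊤ :=
  AlgCoproduct.iSup_range_incl (k := k) (A := fun j => (F j).coord)

theorem iSup_dualRange_comp_incl {G : ProalgGroup k} {q : ∀ j, Hom G (F j)}
    (h : ⨆ j, (q j).dualRange = ⊤) (N : ClosedSubgroup G) :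
    ⨆ j, ((q j).comp N.incl).dualRange = ⊤ := by
  refine eq_top_iff.2 fun b _ => ?_
  obtain ⟨a, rfl⟩ := N.incl_dual_surjective b
  have h1 : ⨆ j, (q j).dualRange ≤ (⨆ j, ((q j).comp N.incl).dualRange).comap
      (N.incl.dual : G.coord →ₐ[k] N.toProalgGroup.coord) := by
    refine iSup_le fun j => ?_
    rintro _ ⟨c, rfl⟩
    exact le_iSup (fun j => ((q j).comp N.incl).dualRange) j ⟨c, rfl⟩
  exact h1 (h ▸ trivial)

/-- A morphism into a projective limit of groups `F i`, from morphisms to the `F i`. -/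
theorem IsProjLimit.exists_lift {G Γ : ProalgGroup k} {I : Type u} [Preorder I]
    {F : I → ProalgGroup k} {t : ∀ {i j : I}, i ≤ j → Hom (F j) (F i)} {p : ∀ i, Hom G (F i)}
    (h : IsProjLimit F t G p) (r : ∀ i, Hom Γ (F i))
    (hr : ∀ (i j : I) (h : i ≤ j), (t h).comp (r j) = r i) :
    ∃ ψ : Hom Γ G, ∀ i, (p i).comp ψ = r i := by
  -- The `k[Γ]`-valued points give an algebra homomorphism `k[G] → k[Γ]`; that it respects the
  -- coalgebra structure is checked on the generating images of the `k[F i]`.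
  obtain ⟨x, hx, -⟩ := h.2 Γ.coord
    (fun i => WithConv.toConv ((r i).dual : (F i).coord →ₐ[k] Γ.coord))
    fun i j hij => Points.ext fun a => congrArg (fun q : Hom Γ (F i) => q.dual a) (hr i j hij)
  have hx' : ∀ i, x.eval.comp ((p i).dual : (F i).coord →ₐ[k] G.coord) = (r i).dual := fun i =>
    AlgHom.ext fun a => congrArg (fun w : (F i).Points Γ.coord => w.eval a) (hx i)
  refine ⟨⟨.ofAlgHom x.eval ?_ ?_⟩, fun i => Hom.ext_dual fun a => congr($(hx' i) a)⟩
  · refine AlgHom.ext_of_iSup_range h.iSup_dualRange fun i => ?_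
    rw [AlgHom.comp_assoc, hx', BialgHom.counitAlgHom_comp, BialgHom.counitAlgHom_comp]
  · refine AlgHom.ext_of_iSup_range h.iSup_dualRange fun i => ?_
    rw [AlgHom.comp_assoc, AlgHom.comp_assoc, hx', ← BialgHom.map_comp_comulAlgHom,
      ← BialgHom.map_comp_comulAlgHom, ← AlgHom.comp_assoc, ← Algebra.TensorProduct.map_comp, hx']

end Free

end ProalgGroup

end

/-! ### The free pro-`C`-group -/

theorem theorem2p13 {k : Type u} [Field k] (C : ProalgGroup k → Prop)
    (hC : ProalgGroup.IsFormation C) (R : Type u) [CommRing R] [Algebra k R] (X : Type u) :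
    ∃ (Γ : ProalgGroup k) (ι : X → Γ.Points R),
      ProalgGroup.IsPro C Γ ∧
      ProalgGroup.ConvergesToOne ι ∧ ProalgGroup.Generates ι ∧
      ∀ (G : ProalgGroup k) (φ : X → G.Points R),
        ProalgGroup.IsPro C G → ProalgGroup.ConvergesToOne φ → ProalgGroup.Generates φ →
          ∃! ψ : ProalgGroup.Hom Γ G, ∀ x, ψ.onPoints (ι x) = φ x := by
  open ProalgGroup in
  obtain ⟨T, F, hF⟩ := exists_small_algebraic k
  let J := {j : Σ t, X → (F t).Points R //
    C (F j.1) ∧ {x | j.2 x ≠ 1}.Finite ∧ Generates j.2}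
  let Φ : X → (pi fun j : J => F j.1.1).Points R := fun x => piPoint fun j => j.1.2 x
  let N := ClosedSubgroup.generatedBy (Set.range Φ)
  let Γ := N.toProalgGroup
  let ι : X → Γ.Points R := toGeneratedBy Φ
  have hι : Generates ι := generates_toGeneratedBy Φ
  let q : ∀ j : J, Hom Γ (F j.1.1) := fun j => (piProj (F := fun j : J => F j.1.1) j).comp N.incl
  have hqι : ∀ j x, (q j).onPoints (ι x) = j.1.2 x := fun j x =>
    piProj_onPoints_piPoint (F := fun j : J => F j.1.1) (fun j => j.1.2 x) j
  have hq : ∀ j, (q j).IsEpi := fun j => j.2.2.2.isEpi (hqι j)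
  have hsup : ⨆ j, (q j).dualRange = ⊤ := iSup_dualRange_comp_incl iSup_dualRange_piProj N
  refine ⟨Γ, ι, hC.isPro (fun j : J => j.2.1) hq hsup,
    convergesToOne_of_iSup q hsup fun j => by simpa only [hqι] using j.2.2.1, hι, ?_⟩
  rintro G φ ⟨I, _, _, _, E, t, p, hE, hid, hcomp, hepi, hlim⟩ hφ hφ'
  have hp : ∀ i, (p i).IsEpi := hlim.isEpi hid hcomp hepi
  have hr : ∀ i, ∃ r : Hom Γ (E i), ∀ x, r.onPoints (ι x) = (p i).onPoints (φ x) := fun i => by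
    obtain ⟨s, ⟨e⟩⟩ := hF (E i) (hC.isAlgebraic _ (hE i))
    let f : Hom (F s) (E i) := ⟨(e : (E i).coord →ₐc[k] (F s).coord)⟩
    let g : Hom (E i) (F s) := ⟨(e.symm : (F s).coord →ₐc[k] (E i).coord)⟩
    have hfg : f.comp g = Hom.id (E i) := Hom.ext_dual fun a => e.symm_apply_apply a
    have hCs : C (F s) := hC.of_iso _ _ g (g.isIso_of_bijective e.symm.bijective) (hE i)
    have hg : (g.comp (p i)).IsEpi := Hom.IsEpi.comp e.symm.injective (hp i)
    -- The image of `φ` in the representative `F s` of `E i` is one of the maps used to build `Γ`,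
    -- so `q j` followed by `F s ≅ E i` is the desired morphism.
    let j : J := ⟨⟨s, fun x => (g.comp (p i)).onPoints (φ x)⟩, hCs,
      hφ.finite hg (hC.isAlgebraic _ hCs), hφ'.map hg⟩
    refine ⟨f.comp (q j), fun x => ?_⟩
    rw [Hom.onPoints_comp, hqι]
    change (f.comp g).onPoints ((p i).onPoints (φ x)) = _
    rw [hfg]
    rfl
  choose r hr using hr
  -- The two morphisms `Γ → E i` agree on `ι(X)`, which generates `Γ`; this gives compatibility with
  -- the transition maps.
  obtain ⟨ψ, hψ⟩ := hlim.exists_lift r fun i j hij => hι.hom_ext fun x => by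
    rw [Hom.onPoints_comp, hr, hr, ← Hom.onPoints_comp, hlim.1]
  have hψι : ∀ x, ψ.onPoints (ι x) = φ x := fun x => WithConv.ofConv_injective <|
    AlgHom.ext_of_iSup_range hlim.iSup_dualRange fun i => AlgHom.ext fun a => by
      have h := hr i x
      rw [← hψ i] at h
      exact congrArg (fun w : (E i).Points R => w.eval a) h
  exact ⟨ψ, hψι, fun ψ' hψ' => hι.hom_ext fun x => (hψ' x).trans (hψι x).symm⟩
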